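/- **Setting.** Consider programs over $N$ variables that consist of a finite set of statements of the four types $a=\&b$ (address-of), $a=b$, $a=*b$ and $*a=b$. Inclusion-based points-to analysis asks, for the least family of sets $(pt(v))_v$ satisfying $b\in pt(a)$ for each statement $a=\&b$, $pt(b)\subseteq pt(a)$ for each $a=b$, $pt(v)\subseteq pt(a)$ for all $v\in pt(b)$ for each $a=*b$, and $pt(b)\subseteq pt(v)$ for all $v\in pt(a)$ for each $*a=b$, to decide for all pairs of variables $p,q$ whether $q\in pt(p)$. The model of computation is the RAM with words of $O(\log n)$ bits and unit-cost instructions. The Boolean product of $n\times n$ matrices $A,B$ is $C$ with $c_{ij}=\bigvee_k(a_{ik}\wedge b_{kj})$. **Corollary (Universality).** Let $K$ be any set of statement types that contains the type $a=\&b$ and at least one of the types $a=b$, $a=*b$, $*a=b$. Then inclusion-based points-to analysis of the programs in which exactly the statement types in $K$ occur is BMM-hard: for every $\delta>0$, if there is a combinatorial algorithm that solves it in time $O(N^{3-\delta})$ for programs with $N$ variables, then there is an $\varepsilon>0$ and a combinatorial algorithm that multiplies $n\times n$ Boolean matrices in time $O(n^{3-\varepsilon})$. Here "combinatorial" is made precise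 through the reduction. For each $K$ there is one reduction, independent of $\delta$ and of the algorithm for points-to analysis, which consists of a preprocessing and a postprocessing of time $O(n^2)$ each that use only copying, constants, array access, addition, comparison, branching and loops. The preprocessing turns two $n\times n$ Boolean matrices into one program with $O(n)$ variables in which exactly the statement types in $K$ occur; from any correct result of the analysis of that program the postprocessing reads off the Boolean product. For every $\delta>0$ and every algorithm $Q$ that solves points-to analysis for these programs in time $O(N^{3-\delta})$, running the preprocessing, $Q$ and the postprocessing one after the other multiplies $n\times n$ Boolean matrices in time $O(n^{3-\varepsilon})$ for some $\varepsilon>0$. So the resulting algorithm is combinatorial whenever $Q$ is. -/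

import Mathlib

/-! Inclusion-based (Andersen-style) points-to analysis. -/

/-- The four types of normalized statements. -/
inductive StmtKind : Type
  | /-- `a = &b` -/ addressOf
  | /-- `a = b` -/ assign
  | /-- `a = *b` -/ assignStar
  | /-- `*a = b` -/ starAssign

/-- A normalized statement over the variables `0, …, N - 1`: its type, the variable `a` occurring
on the left of `=` and the variable `b` occurring on the right of `=`. -/
structure Stmt (N : ℕ) : Type where
  kind : StmtKind
  lhs : Fin N
  rhs : Fin N

/-- The inclusion constraint that a statement imposes on the points-to sets `pt`. -/
def Stmt.Holds {N : ℕ} (pt : Fin N → Set (Fin N)) : Stmt N → Prop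
  | ⟨.addressOf, a, b⟩ => b ∈ pt a
  | ⟨.assign, a, b⟩ => pt b ⊆ pt a
  | ⟨.assignStar, a, b⟩ => ∀ v ∈ pt b, pt v ⊆ pt a
  | ⟨.starAssign, a, b⟩ => ∀ v ∈ pt a, pt b ⊆ pt v

/-- A program with variables `0, …, N - 1`. The analysis is flow-insensitive, so only the set of
statements matters; they are listed without repetition, in an arbitrary order. -/
structure PtrProgram (N : ℕ) : Type where
  stmts : List (Stmt N)
  nodup : stmts.Nodup

/-- `pt` satisfies all the inclusion constraints of the program. -/
def PtrProgram.IsSolution {N : ℕ} (P : PtrProgram N) (pt : Fin N → Set (Fin N)) : Prop :=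
  ∀ s ∈ P.stmts, s.Holds pt

/-- The points-to sets computed by the analysis: the least solution of the constraints. -/
def PtrProgram.pt {N : ℕ} (P : PtrProgram N) (p : Fin N) : Set (Fin N) :=
  {q | ∀ pt : Fin N → Set (Fin N), P.IsSolution pt → q ∈ pt p}

/-- The points-to sets do solve the constraints, so they form the least solution. -/
theorem PtrProgram.isSolution_pt {N : ℕ} (P : PtrProgram N) : P.IsSolution P.pt := by
  rintro ⟨k, a, b⟩ hs
  cases k
  · exact fun pt h => h _ hs
  · exact fun w hw pt h => (h _ hs : pt b ⊆ pt a) (hw pt h)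
  · exact fun v hv w hw pt h =>
      (h _ hs : ∀ v ∈ pt b, pt v ⊆ pt a) v (hv pt h) (hw pt h)
  · exact fun v hv w hw pt h =>
      (h _ hs : ∀ v ∈ pt a, pt b ⊆ pt v) v (hv pt h) (hw pt h)

/-- The statement types that occur in a program. -/
def PtrProgram.kinds {N : ℕ} (P : PtrProgram N) : Set StmtKind :=
  {k | ∃ s ∈ P.stmts, s.kind = k}

/-- A combination of statement types is non-trivial if it has address-of statements and at least
one of the three other types. -/
def NonTrivial (K : Set StmtKind) : Prop :=
  StmtKind.addressOf ∈ K ∧ ∃ k ∈ K, k ≠ StmtKind.addressOf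

/-! A random access machine with bounded words and unit-cost instructions. It has registers and
arrays, of which a given program uses finitely many, and structured control flow. -/

/-- Binary operations on words. -/
inductive Op : Type
  | add | sub | mul | div | mod | land | lor | xor | shl | shr | lt | eq

/-- The value of an operation. -/
def Op.eval : Op → ℕ → ℕ → ℕ
  | .add, x, y => x + y
  | .sub, x, y => x - y
  | .mul, x, y => x * y
  | .div, x, y => x / y
  | .mod, x, y => x % y
  | .land, x, y => x &&& y
  | .lor, x, y => x ||| y
  | .xor, x, y => x ^^^ y
  | .shl, x, y => x <<< y
  | .shr, x, y => x >>> y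
  | .lt, x, y => if x < y then 1 else 0
  | .eq, x, y => if x = y then 1 else 0

/-- Programs of the machine. -/
inductive RAM : Type
  | /-- do nothing -/ skip
  | /-- `r := c` -/ const (r c : ℕ)
  | /-- `r := x` -/ copy (r x : ℕ)
  | /-- `r := o x y` -/ op (o : Op) (r x y : ℕ)
  | /-- `r := a[i]` -/ load (r a i : ℕ)
  | /-- `a[i] := r` -/ store (a i r : ℕ)
  | /-- first `c`, then `d` -/ seq (c d : RAM)
  | /-- if register `r` is non-zero then `c` else `d` -/ ite (r : ℕ) (c d : RAM)
  | /-- while register `r` is non-zero do `c` -/ loop (r : ℕ) (c : RAM)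

/-- The contents of the registers and of the cells of the arrays. -/
@[ext]
structure State : Type where
  reg : ℕ → ℕ
  arr : ℕ → ℕ → ℕ

/-- Write a register. -/
def State.setReg (s : State) (r v : ℕ) : State :=
  { s with reg := Function.update s.reg r v }

/-- Write a cell of an array. -/
def State.setArr (s : State) (a i v : ℕ) : State :=
  { s with arr := Function.update s.arr a (Function.update (s.arr a) i v) }

/-- `Exec W c s t s'`: on a machine whose words hold the numbers below `W`, the program `c`,
started in the state `s`, halts after exactly `t` steps in the state `s'`. A program that tries to
write a number that does not fit into a word gets stuck. -/
inductive Exec (W : ℕ) : RAM → State → ℕ → State → Prop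
  | skip (s : State) : Exec W .skip s 1 s
  | const (s : State) (r c : ℕ) (h : c < W) : Exec W (.const r c) s 1 (s.setReg r c)
  | copy (s : State) (r x : ℕ) (h : s.reg x < W) : Exec W (.copy r x) s 1 (s.setReg r (s.reg x))
  | op (s : State) (o : Op) (r x y : ℕ) (h : o.eval (s.reg x) (s.reg y) < W) :
      Exec W (.op o r x y) s 1 (s.setReg r (o.eval (s.reg x) (s.reg y)))
  | load (s : State) (r a i : ℕ) (h : s.arr a (s.reg i) < W) :
      Exec W (.load r a i) s 1 (s.setReg r (s.arr a (s.reg i)))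
  | store (s : State) (a i r : ℕ) (h : s.reg r < W) :
      Exec W (.store a i r) s 1 (s.setArr a (s.reg i) (s.reg r))
  | seq (s s' s'' : State) (c d : RAM) (t t' : ℕ) (hc : Exec W c s t s') (hd : Exec W d s' t' s'') :
      Exec W (.seq c d) s (t + t') s''
  | ite_true (s s' : State) (r : ℕ) (c d : RAM) (t : ℕ) (h : s.reg r ≠ 0) (hc : Exec W c s t s') :
      Exec W (.ite r c d) s (1 + t) s'
  | ite_false (s s' : State) (r : ℕ) (c d : RAM) (t : ℕ) (h : s.reg r = 0)
      (hd : Exec W d s t s') : Exec W (.ite r c d) s (1 + t) s'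
  | loop_done (s : State) (r : ℕ) (c : RAM) (h : s.reg r = 0) : Exec W (.loop r c) s 1 s
  | loop_step (s s' s'' : State) (r : ℕ) (c : RAM) (t t' : ℕ) (h : s.reg r ≠ 0)
      (hc : Exec W c s t s') (hl : Exec W (.loop r c) s' t' s'') :
      Exec W (.loop r c) s (1 + t + t') s''

/-- `v` is the truth value of `p`, as a bit. -/
def IsBit (v : ℕ) (p : Prop) : Prop := (p → v = 1) ∧ (¬p → v = 0)

/-! Boolean matrix multiplication on the machine. -/

/-- The row-by-row listing of a Boolean matrix, followed by zeros. -/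
def matrixArray {n : ℕ} (A : Matrix (Fin n) (Fin n) Bool) (x : ℕ) : ℕ :=
  if h : x < n * n then
    (A ⟨x / n, Nat.div_lt_of_lt_mul h⟩
      ⟨x % n, Nat.mod_lt _ (Nat.pos_of_mul_pos_left (Nat.zero_lt_of_lt h))⟩).toNat
  else 0

/-- The initial state for the input `A`, `B`: `n` is in register 0, the matrices are in the arrays
0 and 1, and all the rest is zero. -/
def bmmInput {n : ℕ} (A B : Matrix (Fin n) (Fin n) Bool) : State where
  reg r := if r = 0 then n else 0
  arr a := if a = 0 then matrixArray A else if a = 1 then matrixArray B else fun _ => 0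

/-- The array 2 lists the Boolean product of `A` and `B` row by row. -/
def BMMOutput {n : ℕ} (A B : Matrix (Fin n) (Fin n) Bool) (s : State) : Prop :=
  ∀ i j : Fin n, IsBit (s.arr 2 (i * n + j)) (∃ k, A i k = true ∧ B k j = true)

/-- The program `M` multiplies `n × n` Boolean matrices in time `O(n ^ e)` on a machine with words
of `O(log n)` bits. -/
def SolvesBMM (M : RAM) (e : ℝ) : Prop :=
  ∃ (w : ℕ) (C : ℝ), ∀ (n : ℕ) (A B : Matrix (Fin n) (Fin n) Bool),
    ∃ (t : ℕ) (s : State), Exec ((n + 2) ^ w) M (bmmInput A B) t s ∧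
      (t : ℝ) ≤ C * ((n : ℝ) + 1) ^ e ∧ BMMOutput A B s

/-! Points-to analysis on the machine. -/

/-- The number that represents a statement type. -/
def StmtKind.code : StmtKind → ℕ
  | .addressOf => 0
  | .assign => 1
  | .assignStar => 2
  | .starAssign => 3

/-- The initial state for the input `P`: the numbers of variables and of statements are in the
registers 0 and 1, the types, the left variables and the right variables of the statements are in
the arrays 0, 1 and 2, and all the rest is zero. -/
def paInput {N : ℕ} (P : PtrProgram N) : State where
  reg r := if r = 0 then N else if r = 1 then P.stmts.length else 0
  arr a x :=
    if a = 0 then (P.stmts.map fun s => s.kind.code).getD x 0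
    else if a = 1 then (P.stmts.map fun s => (s.lhs : ℕ)).getD x 0
    else if a = 2 then (P.stmts.map fun s => (s.rhs : ℕ)).getD x 0
    else 0

/-- The array 3 tells for all variables `p` and `q`, row by row, whether `p` can point to `q`. -/
def PAOutput {N : ℕ} (P : PtrProgram N) (s : State) : Prop :=
  ∀ p q : Fin N, IsBit (s.arr 3 (p * N + q)) (q ∈ P.pt p)

/-- The program `Q` solves inclusion-based points-to analysis for the programs in which exactly
the statement types in `K` occur, in time `O(N ^ e)` for programs with `N` variables, on a machine
with words of `O(log N)` bits. -/
def SolvesPA (K : Set StmtKind) (Q : RAM) (e : ℝ) : Prop :=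
  ∃ (w : ℕ) (C : ℝ), ∀ (N : ℕ) (P : PtrProgram N), P.kinds = K →
    ∃ (t : ℕ) (s : State), Exec ((N + 2) ^ w) Q (paInput P) t s ∧
      (t : ℝ) ≤ C * ((N : ℝ) + 1) ^ e ∧ PAOutput P s

/-! Combinatorial reductions. -/

/-- The program uses no operations on numbers other than addition and comparisons: no subtraction,
no multiplication or division and no operations on the bits of words. -/
def RAM.Elementary : RAM → Prop
  | .op o _ _ _ => o = .add ∨ o = .lt ∨ o = .eq
  | .seq c d => c.Elementary ∧ d.Elementary
  | .ite _ c d => c.Elementary ∧ d.Elementary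
  | .loop _ c => c.Elementary
  | _ => True

/-- The same program, working on the registers and arrays from number `k` on. -/
def RAM.shift (k : ℕ) : RAM → RAM
  | .skip => .skip
  | .const r c => .const (r + k) c
  | .copy r x => .copy (r + k) (x + k)
  | .op o r x y => .op o (r + k) (x + k) (y + k)
  | .load r a i => .load (r + k) (a + k) (i + k)
  | .store a i r => .store (a + k) (i + k) (r + k)
  | .seq c d => .seq (c.shift k) (d.shift k)
  | .ite r c d => .ite (r + k) (c.shift k) (d.shift k)
  | .loop r c => .loop (r + k) (c.shift k)

/-- The part of a state that a program shifted by `k` works on. -/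
def State.above (k : ℕ) (s : State) : State where
  reg r := s.reg (r + k)
  arr a := s.arr (a + k)

/-- A reduction: a program that prepares the input of a subroutine, the number of registers and
arrays that are protected from the subroutine, and a program that reads off the result. -/
structure Reduction : Type where
  pre : RAM
  k : ℕ
  post : RAM

/-- The algorithm that the reduction makes from the subroutine `Q`. -/
def Reduction.compose (R : Reduction) (Q : RAM) : RAM :=
  .seq R.pre (.seq (Q.shift R.k) R.post)

/-- `R` reduces, in time `O(n ^ 2)` and thus in time linear in the size of the input, the
multiplication of `n × n` Boolean matrices to the points-to analysis of one program that has `O(n)`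
variables and in which exactly the statement types in `K` occur: `pre` writes the program, and from
any correct result of the analysis `post` gets the product of the matrices. -/
def Reduction.ReducesBMM (R : Reduction) (K : Set StmtKind) : Prop :=
  ∃ w C : ℕ, ∀ (n : ℕ) (A B : Matrix (Fin n) (Fin n) Bool),
    ∃ (N : ℕ) (P : PtrProgram N) (t : ℕ) (s : State),
      N ≤ C * (n + 1) ∧ P.kinds = K ∧
      Exec ((n + 2) ^ w) R.pre (bmmInput A B) t s ∧ t ≤ C * (n + 1) ^ 2 ∧
      s.above R.k = paInput P ∧
      ∀ s₁ : State, (∀ r < R.k, s₁.reg r = s.reg r) → (∀ a < R.k, s₁.arr a = s.arr a) →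
        PAOutput P (s₁.above R.k) →
        ∃ (t' : ℕ) (s' : State), Exec ((n + 2) ^ w) R.post s₁ t' s' ∧ t' ≤ C * (n + 1) ^ 2 ∧
          BMMOutput A B s'

/-- Points-to analysis for programs with exactly the statement types in `K` is BMM-hard: there is a
combinatorial reduction, that is, one of quadratic time that uses only elementary instructions,
that turns every points-to analysis algorithm of time `O(N ^ (3 - δ))`, where `N` is the number of
variables, into an algorithm for Boolean matrix multiplication of truly subcubic time. The latter
is the former plus elementary instructions, and therefore combinatorial if the former is. -/
def BMMHard (K : Set StmtKind) : Prop :=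
  ∃ R : Reduction, R.pre.Elementary ∧ R.post.Elementary ∧ R.ReducesBMM K ∧
    ∀ δ : ℝ, 0 < δ → ∀ Q : RAM, SolvesPA K Q (3 - δ) →
      ∃ ε : ℝ, 0 < ε ∧ SolvesBMM (R.compose Q) (3 - ε)

/-! Executions of the machine. -/

/-! The product of `A` and `B` is the reachability relation of a graph with three layers `aᵢ`, `bₖ`,
`cⱼ`. An entry `B k j` becomes `bₖ = &cⱼ`. An entry `A i k` must force `pt(bₖ) ⊆ pt(aᵢ)`, and any
single further statement type `κ` can do this: `aᵢ = bₖ` directly, `aᵢ = *xₖ` when `xₖ` points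
exactly to `bₖ`, or `*yᵢ = bₖ` when `yᵢ` points exactly to `aᵢ`. In each case `cⱼ ∈ pt(aᵢ)` iff the
entry `(i, j)` of the product is true (`Encoding.mem_pt_program`): the derivation is explicit, and
conversely `Encoding.isSolution_points` exhibits a solution with no other pairs. An isolated
variable `d` with `pt(d) = {d}` carries a statement of each type in `K`, so that exactly these types
occur.

There are `5 * n + 1` variables and `O(n ^ 2)` statements, and the machine writes them in quadratic
time without multiplying, by running counters (`Encoding.runs_preRAM`). The subroutine is shifted to
the registers and arrays from 16 on, so by `Exec.shift` it leaves the saved registers intact, and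
`Encoding.runs_postRAM` copies one block of the result. The quadratic overhead and the linear number
of variables preserve subcubic time (`Reduction.ReducesBMM.solvesBMM`).

Code is verified in two layers: loop-free pieces are evaluated symbolically on states with an
explicit list of registers (`RAM.Safe.runs`, `mkState`), and loops follow an indexed family of
states (`Runs.loop`). -/

theorem Exec.mono {W W' : ℕ} (h : W ≤ W') {c : RAM} {s s' : State} {t : ℕ}
    (H : Exec W c s t s') : Exec W' c s t s' := by
  induction H with
  | skip => exact .skip _
  | const s r c h1 => exact .const _ _ _ (h1.trans_le h)
  | copy s r x h1 => exact .copy _ _ _ (h1.trans_le h)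
  | op s o r x y h1 => exact .op _ _ _ _ _ (h1.trans_le h)
  | load s r a i h1 => exact .load _ _ _ _ (h1.trans_le h)
  | store s a i r h1 => exact .store _ _ _ _ (h1.trans_le h)
  | seq _ _ _ _ _ _ _ _ _ ih1 ih2 => exact .seq _ _ _ _ _ _ _ ih1 ih2
  | ite_true _ _ _ _ _ _ h1 _ ih => exact .ite_true _ _ _ _ _ _ h1 ih
  | ite_false _ _ _ _ _ _ h1 _ ih => exact .ite_false _ _ _ _ _ _ h1 ih
  | loop_done _ _ _ h1 => exact .loop_done _ _ _ h1
  | loop_step _ _ _ _ _ _ _ h1 _ _ ih1 ih2 => exact .loop_step _ _ _ _ _ _ _ h1 ih1 ih2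

theorem State.above_setReg (s : State) (k r v : ℕ) :
    (s.setReg (r + k) v).above k = (s.above k).setReg r v := by
  ext x y
  · simp [State.above, State.setReg, Function.update_apply]
  · rfl

theorem State.above_setArr (s : State) (k a i v : ℕ) :
    (s.setArr (a + k) i v).above k = (s.above k).setArr a i v := by
  ext x y
  · rfl
  · by_cases h : x = a <;> simp [State.above, State.setArr, Function.update_apply, h]

/-- The registers and arrays with numbers below `k` agree. -/
def State.EqBelow (k : ℕ) (s s' : State) : Prop :=
  (∀ r < k, s'.reg r = s.reg r) ∧ ∀ a < k, s'.arr a = s.arr a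

theorem State.EqBelow.refl (k : ℕ) (s : State) : s.EqBelow k s := ⟨fun _ _ => rfl, fun _ _ => rfl⟩

theorem State.EqBelow.trans {k : ℕ} {s s' s'' : State} (h : s.EqBelow k s')
    (h' : s'.EqBelow k s'') : s.EqBelow k s'' :=
  ⟨fun r hr => (h'.1 r hr).trans (h.1 r hr), fun a ha => (h'.2 a ha).trans (h.2 a ha)⟩

theorem State.eqBelow_setReg (k : ℕ) (s : State) (r v : ℕ) : s.EqBelow k (s.setReg (r + k) v) :=
  ⟨fun x hx => Function.update_of_ne (by omega) _ _, fun _ _ => rfl⟩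

theorem State.eqBelow_setArr (k : ℕ) (s : State) (a i v : ℕ) :
    s.EqBelow k (s.setArr (a + k) i v) :=
  ⟨fun _ _ => rfl, fun x hx => Function.update_of_ne (by omega) _ _⟩

/-- A shifted program does above `k` what the program does, and nothing below `k`. -/
theorem Exec.shift {W k : ℕ} {c : RAM} {s₀ s₀' : State} {t : ℕ} (H : Exec W c s₀ t s₀') :
    ∀ s : State, s.above k = s₀ →
      ∃ s', Exec W (c.shift k) s t s' ∧ s'.above k = s₀' ∧ s.EqBelow k s' := by
  induction H with
  | skip => exact fun s hs => ⟨s, .skip _, hs, .refl _ _⟩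
  | const s₀ r c h =>
    rintro s rfl
    exact ⟨_, .const _ _ _ h, s.above_setReg k r c, s.eqBelow_setReg k r c⟩
  | copy s₀ r x h =>
    rintro s rfl
    exact ⟨_, .copy _ _ _ h, s.above_setReg k r _, s.eqBelow_setReg k r _⟩
  | op s₀ o r x y h =>
    rintro s rfl
    exact ⟨_, .op _ _ _ _ _ h, s.above_setReg k r _, s.eqBelow_setReg k r _⟩
  | load s₀ r a i h =>
    rintro s rfl
    exact ⟨_, .load _ _ _ _ h, s.above_setReg k r _, s.eqBelow_setReg k r _⟩
  | store s₀ a i r h =>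
    rintro s rfl
    exact ⟨_, .store _ _ _ _ h, s.above_setArr k a _ _, s.eqBelow_setArr k a _ _⟩
  | seq _ _ _ _ _ _ _ _ _ ih1 ih2 =>
    intro s hs
    obtain ⟨s1, e1, a1, b1⟩ := ih1 s hs
    obtain ⟨s2, e2, a2, b2⟩ := ih2 s1 a1
    exact ⟨s2, .seq _ _ _ _ _ _ _ e1 e2, a2, b1.trans b2⟩
  | ite_true _ _ _ _ _ _ h _ ih =>
    rintro s rfl
    obtain ⟨s1, e1, a1, b1⟩ := ih s rfl
    exact ⟨s1, .ite_true _ _ _ _ _ _ h e1, a1, b1⟩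
  | ite_false _ _ _ _ _ _ h _ ih =>
    rintro s rfl
    obtain ⟨s1, e1, a1, b1⟩ := ih s rfl
    exact ⟨s1, .ite_false _ _ _ _ _ _ h e1, a1, b1⟩
  | loop_done _ _ _ h =>
    rintro s rfl
    exact ⟨s, .loop_done _ _ _ h, rfl, .refl _ _⟩
  | loop_step _ _ _ _ _ _ _ h _ _ ih1 ih2 =>
    rintro s rfl
    obtain ⟨s1, e1, a1, b1⟩ := ih1 s rfl
    obtain ⟨s2, e2, a2, b2⟩ := ih2 s1 a1
    exact ⟨s2, .loop_step _ _ _ _ _ _ _ h e1 e2, a2, b1.trans b2⟩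

/-- `c`, started in `s`, halts after at most `T` steps in `s'`. -/
def Runs (W : ℕ) (c : RAM) (s : State) (T : ℕ) (s' : State) : Prop :=
  ∃ t ≤ T, Exec W c s t s'

theorem Runs.seq {W : ℕ} {c d : RAM} {s s' s'' : State} {T T' : ℕ} (h : Runs W c s T s')
    (h' : Runs W d s' T' s'') : Runs W (.seq c d) s (T + T') s'' := by
  obtain ⟨t, ht, e⟩ := h
  obtain ⟨t', ht', e'⟩ := h'
  exact ⟨t + t', by omega, .seq _ _ _ _ _ _ _ e e'⟩

theorem Runs.mono {W : ℕ} {c : RAM} {s s' : State} {T T' : ℕ} (h : Runs W c s T s')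
    (hT : T ≤ T') : Runs W c s T' s' :=
  let ⟨t, ht, e⟩ := h
  ⟨t, ht.trans hT, e⟩

/-- A loop that goes through the states `S 0, …, S m`. -/
theorem Runs.loop {W r m T : ℕ} {c : RAM} (S : ℕ → State) (h0 : ∀ i < m, (S i).reg r ≠ 0)
    (hm : (S m).reg r = 0) (hS : ∀ i < m, Runs W c (S i) T (S (i + 1))) :
    Runs W (.loop r c) (S 0) (m * (T + 1) + 1) (S m) := by
  induction m generalizing S with
  | zero => exact ⟨1, by omega, .loop_done _ _ _ hm⟩
  | succ m ih =>
    obtain ⟨t', ht', e'⟩ := ih (fun i => S (i + 1)) (fun i hi => h0 _ (by omega)) hm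
      (fun i hi => hS _ (by omega))
    obtain ⟨t, ht, e⟩ := hS 0 (by omega)
    exact ⟨1 + t + t', by linarith, .loop_step _ _ _ _ _ _ _ (h0 0 (by omega)) e e'⟩

/-! Loop-free programs. -/

/-- The effect of a loop-free program. -/
def RAM.eval : RAM → State → State
  | .skip, s => s
  | .const r c, s => s.setReg r c
  | .copy r x, s => s.setReg r (s.reg x)
  | .op o r x y, s => s.setReg r (o.eval (s.reg x) (s.reg y))
  | .load r a i, s => s.setReg r (s.arr a (s.reg i))
  | .store a i r, s => s.setArr a (s.reg i) (s.reg r)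
  | .seq c d, s => d.eval (c.eval s)
  | .ite r c d, s => if s.reg r = 0 then d.eval s else c.eval s
  | .loop _ _, s => s

/-- The program is loop-free and writes only numbers below `W`. -/
def RAM.Safe (W : ℕ) : RAM → State → Prop
  | .skip, _ => True
  | .const _ c, _ => c < W
  | .copy _ x, s => s.reg x < W
  | .op o _ x y, s => o.eval (s.reg x) (s.reg y) < W
  | .load _ a i, s => s.arr a (s.reg i) < W
  | .store _ _ r, s => s.reg r < W
  | .seq c d, s => c.Safe W s ∧ d.Safe W (c.eval s)
  | .ite r c d, s => if s.reg r = 0 then d.Safe W s else c.Safe W s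
  | .loop _ _, _ => False

/-- A bound on the number of steps of a loop-free program. -/
def RAM.cost : RAM → ℕ
  | .seq c d => c.cost + d.cost
  | .ite _ c d => 1 + (c.cost + d.cost)
  | _ => 1

/-- This replaces execution derivations by computing `eval` and `Safe` with `simp`. The cost adds
both branches of a conditional, so it does not depend on the state. -/
theorem RAM.Safe.runs {W : ℕ} {c : RAM} {s : State} (h : c.Safe W s) :
    Runs W c s c.cost (c.eval s) := by
  induction c generalizing s with
  | skip => exact ⟨1, le_rfl, .skip _⟩
  | const r c => exact ⟨1, le_rfl, .const _ _ _ h⟩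
  | copy r x => exact ⟨1, le_rfl, .copy _ _ _ h⟩
  | op o r x y => exact ⟨1, le_rfl, .op _ _ _ _ _ h⟩
  | load r a i => exact ⟨1, le_rfl, .load _ _ _ _ h⟩
  | store a i r => exact ⟨1, le_rfl, .store _ _ _ _ h⟩
  | seq c d ihc ihd => exact (ihc h.1).seq (ihd h.2)
  | ite r c d ihc ihd =>
    by_cases hr : s.reg r = 0
    · simp only [RAM.Safe, hr, if_true] at h
      obtain ⟨t, ht, e⟩ := ihd h
      exact ⟨1 + t, by simp only [RAM.cost]; omega, by
        simpa [RAM.eval, hr] using Exec.ite_false _ _ _ c _ _ hr e⟩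
    · simp only [RAM.Safe, hr, if_false] at h
      obtain ⟨t, ht, e⟩ := ihc h
      exact ⟨1 + t, by simp only [RAM.cost]; omega, by
        simpa [RAM.eval, hr] using Exec.ite_true _ _ _ _ d _ hr e⟩
  | loop r c => exact h.elim

/-- The state with the registers `l`, followed by those of `f`, and the arrays `g`. -/
def mkState (l : List ℕ) (f : ℕ → ℕ) (g : ℕ → ℕ → ℕ) : State where
  reg r := l.getD r (f r)
  arr := g

@[simp] theorem mkState_reg (l : List ℕ) (f : ℕ → ℕ) (g : ℕ → ℕ → ℕ) (r : ℕ) :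
    (mkState l f g).reg r = l.getD r (f r) := rfl

@[simp] theorem mkState_arr (l : List ℕ) (f : ℕ → ℕ) (g : ℕ → ℕ → ℕ) :
    (mkState l f g).arr = g := rfl

theorem mkState_setReg {l : List ℕ} {r : ℕ} (h : r < l.length) (f : ℕ → ℕ) (g : ℕ → ℕ → ℕ)
    (v : ℕ) : (mkState l f g).setReg r v = mkState (l.set r v) f g := by
  ext x y
  · rcases eq_or_ne x r with rfl | hx
    · simp [State.setReg, h]
    · simp [State.setReg, hx, List.getD_eq_getElem?_getD, List.getElem?_set_ne hx.symm]
  · rfl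

theorem mkState_setArr (l : List ℕ) (f : ℕ → ℕ) (g : ℕ → ℕ → ℕ) (a i v : ℕ) :
    (mkState l f g).setArr a i v =
      mkState l f (Function.update g a (Function.update (g a) i v)) := rfl

/-- This recovers the explicit form of a state of which only the first registers are known, as after
a subroutine call. -/
theorem eq_mkState {s : State} {l : List ℕ} (h : ∀ r < l.length, s.reg r = l.getD r 0) :
    s = mkState l s.reg s.arr := by
  ext x y
  · by_cases hx : x < l.length
    · simpa [hx] using h x hx
    · simp [List.getD_eq_getElem?_getD, hx]
  · rfl

/-! A reduction turns fast points-to analysis into fast matrix multiplication. -/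

theorem Reduction.ReducesBMM.solvesBMM {R : Reduction} {K : Set StmtKind} (hR : R.ReducesBMM K)
    {δ : ℝ} (hδ : 0 < δ) {Q : RAM} (hQ : SolvesPA K Q (3 - δ)) :
    ∃ ε : ℝ, 0 < ε ∧ SolvesBMM (R.compose Q) (3 - ε) := by
  obtain ⟨w, C, hR⟩ := hR
  obtain ⟨v, D, hQ⟩ := hQ
  -- The cap at 1 keeps the exponent `3 - ε` at least 2, so it absorbs the quadratic pre- and
  -- postprocessing.
  set ε := min δ 1
  have hε1 : ε ≤ 1 := min_le_right _ _
  have hεδ : ε ≤ δ := min_le_left _ _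
  refine ⟨ε, lt_min hδ one_pos, max w ((C + 3) * v), 2 * C + |D| * ((C : ℝ) + 1) ^ (3 - ε),
    fun n A B => ?_⟩
  obtain ⟨N, P, t, s, hN, hP, hpre, ht, hs, hpost⟩ := hR n A B
  obtain ⟨tq, sq, eq, htq, hout⟩ := hQ N P hP
  obtain ⟨s₁, e₁, ha, hb⟩ := eq.shift s hs
  obtain ⟨t', s', e', ht', hfin⟩ := hpost s₁ hb.1 hb.2 (ha ▸ hout)
  have hw : (n + 2) ^ w ≤ (n + 2) ^ max w ((C + 3) * v) :=
    Nat.pow_le_pow_right (by omega) (le_max_left _ _)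
  have hv : (N + 2) ^ v ≤ (n + 2) ^ max w ((C + 3) * v) := by
    -- The constant factor is absorbed into the exponent because `2 ≤ n + 2`; thus the words that
    -- the subroutine needs still have `O(log n)` bits.
    have h1 : N + 2 ≤ (n + 2) ^ (C + 3) :=
      calc N + 2 ≤ (C + 2) * (n + 2) := by nlinarith
        _ ≤ 2 ^ (C + 2) * (n + 2) := Nat.mul_le_mul_right _ Nat.lt_two_pow_self.le
        _ ≤ (n + 2) ^ (C + 2) * (n + 2) :=
          Nat.mul_le_mul_right _ (Nat.pow_le_pow_left (by omega) _)
        _ = (n + 2) ^ (C + 3) := (pow_succ _ _).symm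
    calc (N + 2) ^ v ≤ ((n + 2) ^ (C + 3)) ^ v := Nat.pow_le_pow_left h1 _
      _ = (n + 2) ^ ((C + 3) * v) := (pow_mul _ _ _).symm
      _ ≤ _ := Nat.pow_le_pow_right (by omega) (le_max_right _ _)
  refine ⟨_, s', (hpre.mono hw).seq _ _ _ _ _ _ _ ((e₁.mono hv).seq _ _ _ _ _ _ _ (e'.mono hw)),
    ?_, hfin⟩
  have hn1 : (1 : ℝ) ≤ (n : ℝ) + 1 := by linarith [(Nat.cast_nonneg n : (0 : ℝ) ≤ n)]
  have hN1 : (1 : ℝ) ≤ (N : ℝ) + 1 := by linarith [(Nat.cast_nonneg N : (0 : ℝ) ≤ N)]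
  have hsq : ((n : ℝ) + 1) ^ 2 ≤ ((n : ℝ) + 1) ^ (3 - ε) := by
    rw [← Real.rpow_natCast]
    exact Real.rpow_le_rpow_of_exponent_le hn1 (by push_cast; linarith)
  have h1 : (t : ℝ) ≤ C * ((n : ℝ) + 1) ^ (3 - ε) :=
    (by exact_mod_cast ht : (t : ℝ) ≤ C * ((n : ℝ) + 1) ^ 2).trans (by gcongr)
  have h2 : (t' : ℝ) ≤ C * ((n : ℝ) + 1) ^ (3 - ε) :=
    (by exact_mod_cast ht' : (t' : ℝ) ≤ C * ((n : ℝ) + 1) ^ 2).trans (by gcongr)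
  have hNC : (N : ℝ) + 1 ≤ ((C : ℝ) + 1) * ((n : ℝ) + 1) := by
    have : (N : ℝ) ≤ C * ((n : ℝ) + 1) := by exact_mod_cast hN
    linarith
  have h3 : (tq : ℝ) ≤ |D| * ((C : ℝ) + 1) ^ (3 - ε) * ((n : ℝ) + 1) ^ (3 - ε) :=
    calc (tq : ℝ) ≤ D * ((N : ℝ) + 1) ^ (3 - δ) := htq
      _ ≤ |D| * ((N : ℝ) + 1) ^ (3 - δ) := by gcongr; exact le_abs_self D
      _ ≤ |D| * ((N : ℝ) + 1) ^ (3 - ε) := by gcongr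
      _ ≤ |D| * (((C : ℝ) + 1) * ((n : ℝ) + 1)) ^ (3 - ε) := by
        gcongr
        linarith
      _ = _ := by rw [Real.mul_rpow (by positivity) (by positivity), mul_assoc]
  push_cast
  linarith

/-! The program that encodes two Boolean matrices. Its variables are `aᵢ = i`, `bᵢ = n + i`,
`cᵢ = 2 n + i`, `xᵢ = 3 n + i`, `yᵢ = 4 n + i` and `d = 5 n`, where `xᵢ` points to `bᵢ`, `yᵢ` to
`aᵢ` and `d` to itself. -/

namespace Encoding

/-- The first variable on the left of the statements for the first matrix. -/
def leftBase (n : ℕ) : StmtKind → ℕ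
  | .starAssign => 4 * n
  | _ => 0

/-- The first variable on the right of the statements for the first matrix. -/
def rightBase (n : ℕ) : StmtKind → ℕ
  | .assignStar => 3 * n
  | _ => n

/-- The statements for the entries number `x` of both matrices, in row `i` and column `j`. -/
def cell (n : ℕ) (κ : StmtKind) (A B : ℕ → ℕ) (i j x : ℕ) : List (StmtKind × ℕ × ℕ) :=
  (if A x = 0 then [] else [(κ, leftBase n κ + i, rightBase n κ + j)]) ++
    (if B x = 0 then [] else [(.addressOf, n + i, 2 * n + j)])

/-- The statements for the entries of row `i` in the first `m` columns. -/
def row (n : ℕ) (κ : StmtKind) (A B : ℕ → ℕ) (i m : ℕ) : List (StmtKind × ℕ × ℕ) :=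
  [(.addressOf, 3 * n + i, n + i), (.addressOf, 4 * n + i, i)] ++
    (List.range m).flatMap fun j => cell n κ A B i j (i * n + j)

/-- The statements that make sure that the types `ks` occur. -/
def dummies (n : ℕ) (ks : List StmtKind) : List (StmtKind × ℕ × ℕ) :=
  ks.map fun k => (k, 5 * n, 5 * n)

/-- The statements for the first `m` rows. -/
def stmts (n : ℕ) (κ : StmtKind) (ks : List StmtKind) (A B : ℕ → ℕ) (m : ℕ) :
    List (StmtKind × ℕ × ℕ) :=
  dummies n ks ++ (List.range m).flatMap fun i => row n κ A B i n

/-! ### Size, members and distinctness of the statements. -/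

variable {n : ℕ} {κ : StmtKind} {ks : List StmtKind} {A B : ℕ → ℕ}

theorem row_succ (i m : ℕ) : row n κ A B i (m + 1) =
    row n κ A B i m ++ cell n κ A B i m (i * n + m) := by
  simp [row, List.range_succ]

theorem stmts_succ (m : ℕ) : stmts n κ ks A B (m + 1) =
    stmts n κ ks A B m ++ row n κ A B m n := by
  simp [stmts, List.range_succ]

theorem length_cell (i j x : ℕ) : (cell n κ A B i j x).length ≤ 2 := by
  unfold cell; split <;> split <;> simp

theorem length_row (i m : ℕ) : (row n κ A B i m).length ≤ 2 + 2 * m := by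
  induction m with
  | zero => simp [row]
  | succ m ih =>
    rw [row_succ, List.length_append]
    have := length_cell (n := n) (κ := κ) (A := A) (B := B) i m (i * n + m)
    omega

theorem length_stmts (m : ℕ) :
    (stmts n κ ks A B m).length ≤ ks.length + m * (2 + 2 * n) := by
  induction m with
  | zero => simp [stmts, dummies]
  | succ m ih =>
    rw [stmts_succ, List.length_append, Nat.succ_mul]
    have := length_row (n := n) (κ := κ) (A := A) (B := B) m n
    omega

theorem mem_cell {i j x : ℕ} {t : StmtKind × ℕ × ℕ} : t ∈ cell n κ A B i j x ↔
    (A x ≠ 0 ∧ t = (κ, leftBase n κ + i, rightBase n κ + j)) ∨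
      (B x ≠ 0 ∧ t = (.addressOf, n + i, 2 * n + j)) := by
  unfold cell; split <;> split <;> simp [*]

theorem mem_row {i m : ℕ} {t : StmtKind × ℕ × ℕ} : t ∈ row n κ A B i m ↔
    t = (.addressOf, 3 * n + i, n + i) ∨ t = (.addressOf, 4 * n + i, i) ∨
      ∃ j < m, t ∈ cell n κ A B i j (i * n + j) := by
  simp [row]

theorem mem_stmts {m : ℕ} {t : StmtKind × ℕ × ℕ} : t ∈ stmts n κ ks A B m ↔
    (∃ k ∈ ks, t = (k, 5 * n, 5 * n)) ∨ ∃ i < m, t ∈ row n κ A B i n := by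
  simp [stmts, dummies, eq_comm]

theorem nodup_cell (hκ : κ ≠ .addressOf) (i j x : ℕ) : (cell n κ A B i j x).Nodup := by
  unfold cell; split <;> split <;> simp [hκ]

/-- The type `κ ≠ .addressOf` separates the statements for the first matrix from the others; the
rest differ in their variables, as the groups occupy disjoint ranges. -/
theorem nodup_row (hκ : κ ≠ .addressOf) {i : ℕ} (hi : i < n) : (row n κ A B i n).Nodup := by
  refine List.Nodup.append (by simp; omega) ?_ ?_
  · refine List.nodup_flatMap.2 ⟨fun j _ => nodup_cell hκ _ _ _, ?_⟩
    refine List.Pairwise.imp (fun {j j'} (h : j ≠ j') t ht ht' => ?_) List.nodup_range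
    rw [mem_cell] at ht ht'
    rcases ht with ⟨_, rfl⟩ | ⟨_, rfl⟩ <;> rcases ht' with ⟨_, ht'⟩ | ⟨_, ht'⟩ <;>
      simp at ht' <;> first | omega | exact hκ ht'.1 | exact hκ ht'.1.symm
  · intro t ht ht'
    simp only [List.mem_flatMap, List.mem_range, mem_cell] at ht'
    obtain ⟨j, hj, ⟨_, rfl⟩ | ⟨_, rfl⟩⟩ := ht'
    · simp [hκ] at ht
    · simp at ht
      omega

theorem leftBase_lt {i : ℕ} (hi : i < n) : leftBase n κ + i < 5 * n := by
  cases κ <;> simp only [leftBase] <;> omega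

theorem rightBase_lt {i : ℕ} (hi : i < n) : rightBase n κ + i < 5 * n := by
  cases κ <;> simp only [rightBase] <;> omega

theorem lt_of_mem_row {i : ℕ} (hi : i < n) {t : StmtKind × ℕ × ℕ} (ht : t ∈ row n κ A B i n) :
    t.2.1 < 5 * n ∧ t.2.2 < 5 * n := by
  rw [mem_row] at ht
  simp only [mem_cell] at ht
  rcases ht with rfl | rfl | ⟨j, hj, ⟨_, rfl⟩ | ⟨_, rfl⟩⟩
  · simp only; omega
  · simp only; omega
  · exact ⟨leftBase_lt hi, rightBase_lt hj⟩
  · simp only; omega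

theorem nodup_stmts (hκ : κ ≠ .addressOf) (hks : ks.Nodup) : (stmts n κ ks A B n).Nodup := by
  refine List.Nodup.append (hks.map fun k k' h => by simpa using h) ?_ ?_
  · refine List.nodup_flatMap.2 ⟨fun i hi => nodup_row hκ (List.mem_range.1 hi), ?_⟩
    have : (List.range n).Pairwise (fun i i' => i ≠ i' ∧ i < n ∧ i' < n) :=
      (List.Pairwise.and_mem.1 List.nodup_range).imp fun h =>
        ⟨h.2.2, List.mem_range.1 h.1, List.mem_range.1 h.2.1⟩
    refine this.imp fun {i i'} h t ht ht' => ?_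
    obtain ⟨hne, hi, hi'⟩ := h
    simp only [mem_row, mem_cell] at ht ht'
    rcases ht with rfl | rfl | ⟨j, hj, ⟨_, rfl⟩ | ⟨_, rfl⟩⟩ <;>
      rcases ht' with ht' | ht' | ⟨j', hj', ⟨_, ht'⟩ | ⟨_, ht'⟩⟩ <;>
      simp only [Prod.mk.injEq, true_and] at ht' <;>
      first | omega | exact hκ ht'.1 | exact hκ ht'.1.symm
  · intro t ht ht'
    simp only [dummies, List.mem_map, List.mem_flatMap, List.mem_range] at ht ht'
    obtain ⟨k, _, rfl⟩ := ht
    obtain ⟨i, hi, h⟩ := ht'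
    exact lt_irrefl _ (lt_of_mem_row hi h).1

theorem lt_of_mem_stmts {t : StmtKind × ℕ × ℕ} (ht : t ∈ stmts n κ ks A B n) :
    t.2.1 < 5 * n + 1 ∧ t.2.2 < 5 * n + 1 := by
  rcases mem_stmts.1 ht with ⟨k, _, rfl⟩ | ⟨i, hi, h⟩
  · simp
  · have := lt_of_mem_row hi h
    omega

/-- The statement with the type and variables `t`. -/
def toStmt (n : ℕ) (t : StmtKind × ℕ × ℕ) : Stmt (5 * n + 1) :=
  ⟨t.1, Fin.ofNat _ t.2.1, Fin.ofNat _ t.2.2⟩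

/-- `Fin.ofNat` reduces modulo `5 * n + 1`, which changes nothing for variables in range. -/
theorem lhs_toStmt {t : StmtKind × ℕ × ℕ} (ht : t ∈ stmts n κ ks A B n) :
    ((toStmt n t).lhs : ℕ) = t.2.1 := by
  simpa [toStmt] using (lt_of_mem_stmts ht).1

theorem rhs_toStmt {t : StmtKind × ℕ × ℕ} (ht : t ∈ stmts n κ ks A B n) :
    ((toStmt n t).rhs : ℕ) = t.2.2 := by
  simpa [toStmt] using (lt_of_mem_stmts ht).2

/-- The program that encodes the matrices `A` and `B`. -/
def program (A B : ℕ → ℕ) (hκ : κ ≠ .addressOf) (hks : ks.Nodup) : PtrProgram (5 * n + 1) where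
  stmts := (stmts n κ ks A B n).map (toStmt n)
  nodup := (nodup_stmts hκ hks).map_on fun t ht t' ht' h => by
    have h1 := lhs_toStmt ht
    have h2 := rhs_toStmt ht
    rw [h, lhs_toStmt ht'] at h1
    rw [h, rhs_toStmt ht'] at h2
    exact Prod.ext (congrArg Stmt.kind h) (Prod.ext h1.symm h2.symm)

/-- The statements on `d` supply every type in `ks`, even for zero matrices or `n = 0`; all others
have type `κ` or `.addressOf`. -/
theorem kinds_program (hκ : κ ≠ .addressOf) (hks : ks.Nodup) (hκs : κ ∈ ks)
    (h0 : .addressOf ∈ ks) : (program (n := n) A B hκ hks).kinds = {k | k ∈ ks} := by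
  ext k
  simp only [PtrProgram.kinds, program, List.mem_map, Set.mem_ofPred_eq]
  constructor
  · rintro ⟨_, ⟨t, ht, rfl⟩, rfl⟩
    simp only [mem_stmts, mem_row, mem_cell] at ht
    rcases ht with ⟨k, hk, rfl⟩ | ⟨i, hi, rfl | rfl | ⟨j, hj, ⟨_, rfl⟩ | ⟨_, rfl⟩⟩⟩ <;> assumption
  · exact fun hk => ⟨_, ⟨_, mem_stmts.2 (.inl ⟨k, hk, rfl⟩), rfl⟩, rfl⟩

/-- The points-to sets of the program. -/
def Points (n : ℕ) (A B : ℕ → ℕ) (p q : ℕ) : Prop :=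
  (∃ i k j, i < n ∧ k < n ∧ j < n ∧ A (i * n + k) ≠ 0 ∧ B (k * n + j) ≠ 0 ∧
      p = i ∧ q = 2 * n + j) ∨
    (∃ k j, k < n ∧ j < n ∧ B (k * n + j) ≠ 0 ∧ p = n + k ∧ q = 2 * n + j) ∨
    (∃ i < n, p = 3 * n + i ∧ q = n + i) ∨
    (∃ i < n, p = 4 * n + i ∧ q = i) ∨ (p = 5 * n ∧ q = 5 * n)

/-- This is the upper bound on the least solution: nothing beyond `Points` can be derived. -/
theorem isSolution_points (hκ : κ ≠ .addressOf) (hks : ks.Nodup) :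
    (program (n := n) A B hκ hks).IsSolution fun p => {q | Points n A B p q} := by
  intro s hs
  simp only [program, List.mem_map] at hs
  obtain ⟨t, ht, rfl⟩ := hs
  have hl := lhs_toStmt ht
  have hr := rhs_toStmt ht
  generalize hst : toStmt n t = st at hl hr
  obtain ⟨k, a, b⟩ := st
  obtain rfl : t.1 = k := congrArg Stmt.kind hst
  simp only [mem_stmts, mem_row, mem_cell] at ht
  simp only at hl hr
  -- The groups of variables are disjoint intervals, so for `p` in a given group only one disjunct
  -- of `Points` survives; `omega` refutes the others.
  have hd : ∀ q, Points n A B (5 * n) q ↔ q = 5 * n := by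
    intro q
    constructor
    · rintro (h | h | h | h | h)
      · obtain ⟨i, k, j, hi, hk, hj, -, -, h, h'⟩ := h
        omega
      · obtain ⟨k, j, hk, hj, -, h, h'⟩ := h
        omega
      · obtain ⟨i, hi, h, h'⟩ := h
        omega
      · obtain ⟨i, hi, h, h'⟩ := h
        omega
      · exact h.2
    · exact fun h => .inr (.inr (.inr (.inr ⟨rfl, h⟩)))
  have hb : ∀ k < n, ∀ q, Points n A B (n + k) q →
      ∃ j < n, B (k * n + j) ≠ 0 ∧ q = 2 * n + j := by
    rintro k hk q (h | h | h | h | h)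
    · obtain ⟨i, k, j, hi, hk, hj, -, -, h, h'⟩ := h
      omega
    · obtain ⟨k', j, hk, hj, hB, h, h'⟩ := h
      obtain rfl : k = k' := by omega
      exact ⟨j, hj, hB, h'⟩
    · obtain ⟨i, hi, h, h'⟩ := h
      omega
    · obtain ⟨i, hi, h, h'⟩ := h
      omega
    · omega
  have hx : ∀ k < n, ∀ q, Points n A B (3 * n + k) q → q = n + k := by
    rintro k hk q (h | h | h | h | h)
    · obtain ⟨i, k, j, hi, hk, hj, -, -, h, h'⟩ := h
      omega
    · obtain ⟨k', j, hk, hj, hB, h, h'⟩ := h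
      omega
    · obtain ⟨i, hi, h, h'⟩ := h
      omega
    · obtain ⟨i, hi, h, h'⟩ := h
      omega
    · omega
  have hy : ∀ k < n, ∀ q, Points n A B (4 * n + k) q → q = k := by
    rintro k hk q (h | h | h | h | h)
    · obtain ⟨i, k, j, hi, hk, hj, -, -, h, h'⟩ := h
      omega
    · obtain ⟨k', j, hk, hj, hB, h, h'⟩ := h
      omega
    · obtain ⟨i, hi, h, h'⟩ := h
      omega
    · obtain ⟨i, hi, h, h'⟩ := h
      omega
    · omega
  rcases ht with ⟨k, hk, rfl⟩ | ⟨i, hi, rfl | rfl | ⟨j, hj, ⟨hA, rfl⟩ | ⟨hB, rfl⟩⟩⟩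
  · cases k <;> simp [Stmt.Holds, hl, hr, hd]
    · intro v hv w
      simp [hv, hd]
    · intro v hv w
      simp [hv, hd]
  · simp only [Stmt.Holds, Set.mem_ofPred_eq, hl, hr]
    exact .inr (.inr (.inl ⟨i, hi, rfl, rfl⟩))
  · simp only [Stmt.Holds, Set.mem_ofPred_eq, hl, hr]
    exact .inr (.inr (.inr (.inl ⟨i, hi, rfl, rfl⟩)))
  -- All three choices of `κ` reduce to this inclusion, since a pointee of `xⱼ` is `bⱼ` and a
  -- pointee of `yᵢ` is `aᵢ`.
  · have key : ∀ q, Points n A B (n + j) q → Points n A B i q := by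
      intro q hq
      obtain ⟨l, hl, hB, rfl⟩ := hb j hj q hq
      exact .inl ⟨i, j, l, hi, hj, hl, hA, hB, rfl, rfl⟩
    cases κ with
    | addressOf => exact absurd rfl hκ
    | assign =>
      simp only [leftBase, rightBase, zero_add] at hl hr
      simpa [Stmt.Holds, hl, hr] using fun q : Fin _ => key q
    | assignStar =>
      simp only [leftBase, rightBase, zero_add] at hl hr
      simp only [Stmt.Holds, Set.mem_ofPred_eq, hl, hr, Set.ofPred_subset_ofPred]
      intro v hv q hq
      rw [hx j hj _ hv] at hq
      exact key _ hq
    | starAssign =>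
      simp only [leftBase, rightBase] at hl hr
      simp only [Stmt.Holds, Set.mem_ofPred_eq, hl, hr, Set.ofPred_subset_ofPred]
      intro v hv q hq
      rw [hy i hi _ hv]
      exact key _ hq
  · simp only [Stmt.Holds, Set.mem_ofPred_eq, hl, hr]
    exact .inr (.inl ⟨i, j, hi, hj, hB, rfl, rfl⟩)

theorem mem_pt_program (hκ : κ ≠ .addressOf) (hks : ks.Nodup) {i j : ℕ} (hi : i < n)
    (hj : j < n) {p q : Fin (5 * n + 1)} (hp : (p : ℕ) = i) (hq : (q : ℕ) = 2 * n + j) :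
    q ∈ (program A B hκ hks).pt p ↔ ∃ k < n, A (i * n + k) ≠ 0 ∧ B (k * n + j) ≠ 0 := by
  constructor
  · intro h
    have := h _ (isSolution_points hκ hks)
    simp only [Set.mem_ofPred_eq, hp, hq] at this
    rcases this with h | h | h | h | h
    · obtain ⟨i', k, j', hi', hk, hj', hA, hB, rfl, h'⟩ := h
      obtain rfl : j = j' := by omega
      exact ⟨k, hk, hA, hB⟩
    · obtain ⟨k', j, hk, hj, hB, h, h'⟩ := h
      omega
    · obtain ⟨i, hi, h, h'⟩ := h
      omega
    · obtain ⟨i, hi, h, h'⟩ := h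
      omega
    · omega
  · rintro ⟨k, hk, hA, hB⟩
    have key : ∀ t ∈ stmts n κ ks A B n, (toStmt n t).Holds (program A B hκ hks).pt := fun t ht =>
      (program A B hκ hks).isSolution_pt _ (List.mem_map.2 ⟨t, ht, rfl⟩)
    have hof : ∀ (r : Fin (5 * n + 1)) (m : ℕ), (r : ℕ) = m → Fin.ofNat _ m = r := by
      rintro r m rfl
      simp
    obtain ⟨b, hb⟩ : ∃ b : Fin (5 * n + 1), (b : ℕ) = n + k := ⟨⟨n + k, by omega⟩, rfl⟩
    obtain ⟨x, hx⟩ : ∃ x : Fin (5 * n + 1), (x : ℕ) = 3 * n + k := ⟨⟨3 * n + k, by omega⟩, rfl⟩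
    obtain ⟨y, hy⟩ : ∃ y : Fin (5 * n + 1), (y : ℕ) = 4 * n + i := ⟨⟨4 * n + i, by omega⟩, rfl⟩
    -- The four statements of the derivation: `bₖ = &cⱼ`, the `κ`-statement for `A i k`, `xₖ = &bₖ`
    -- and `yᵢ = &aᵢ`.
    have h1 := key _ (mem_stmts.2 (.inr ⟨k, hk, mem_row.2 (.inr (.inr ⟨j, hj,
      mem_cell.2 (.inr ⟨hB, rfl⟩)⟩))⟩))
    have h2 := key _ (mem_stmts.2 (.inr ⟨i, hi, mem_row.2 (.inr (.inr ⟨k, hk,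
      mem_cell.2 (.inl ⟨hA, rfl⟩)⟩))⟩))
    have h3 := key _ (mem_stmts.2 (.inr ⟨k, hk, mem_row.2 (.inl rfl)⟩))
    have h4 := key _ (mem_stmts.2 (.inr ⟨i, hi, mem_row.2 (.inr (.inl rfl))⟩))
    simp only [toStmt, Stmt.Holds, hof _ _ hb, hof _ _ hx, hof _ _ hy, hof _ _ hp,
      hof _ _ hq] at h1 h3 h4
    cases κ with
    | addressOf => exact absurd rfl hκ
    | assign =>
      simp only [toStmt, Stmt.Holds, leftBase, rightBase, zero_add, hof _ _ hb, hof _ _ hp] at h2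
      exact h2 h1
    | assignStar =>
      simp only [toStmt, Stmt.Holds, leftBase, rightBase, zero_add, hof _ _ hx, hof _ _ hp] at h2
      exact h2 _ h3 h1
    | starAssign =>
      simp only [toStmt, Stmt.Holds, leftBase, rightBase, hof _ _ hy, hof _ _ hb] at h2
      exact h2 _ h4 h1

end Encoding

theorem State.reg_setArr (s : State) (a i v : ℕ) : (s.setArr a i v).reg = s.reg := rfl

/-! The preprocessing. The registers from 0 on hold `n`, the row `i`, the column `j`, the number
`x = i * n + j` of the entry, the constant 1, the conditions of the two loops, two variables, the
first variables of the five groups but for 0 and `n`, the first variables on both sides of the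
statements for the first matrix, and the current type; from 16 on there is the output. -/

namespace Encoding

/-- Append the statement with the type `c` and the variables in the registers `a` and `b`. -/
def emit (c a b : ℕ) : RAM :=
  -- Arrays 16 to 18 and register 17 are arrays 0 to 2 and register 1 of the shifted subroutine, so
  -- the write position is also the statement count. Clearing register 15 restores the standard form
  -- of the state.
  .seq (.const 15 c) <| .seq (.store 16 17 15) <| .seq (.store 17 17 a) <|
    .seq (.store 18 17 b) <| .seq (.op .add 17 17 4) (.const 15 0)

/-- The statements for the entry in registers 1 to 3. -/
def cellRAM (κ : StmtKind) : RAM :=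
  .seq (.load 15 0 3) <|
  .seq (.ite 15 (.seq (.op .add 7 13 1) <| .seq (.op .add 8 14 2) (emit κ.code 7 8)) .skip) <|
  .seq (.load 15 1 3) <|
  .seq (.ite 15 (.seq (.op .add 7 0 1) <| .seq (.op .add 8 9 2) (emit StmtKind.addressOf.code 7 8)) .skip) <|
  .seq (.const 7 0) <| .seq (.const 8 0) <| .seq (.const 15 0) <|
  .seq (.op .add 3 3 4) <| .seq (.op .add 2 2 4) (.op .lt 6 2 0)

def rowStartRAM : RAM :=
  .seq (.op .add 7 10 1) <| .seq (.op .add 8 0 1) <| .seq (emit StmtKind.addressOf.code 7 8) <|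
  .seq (.op .add 7 11 1) <| .seq (emit StmtKind.addressOf.code 7 1) <|
  .seq (.const 7 0) <| .seq (.const 8 0) (.op .lt 6 2 0)

/-- Register 3 is not reset: rows are contiguous, so it already holds the number of the next row's
first entry, without a multiplication. -/
def rowEndRAM : RAM :=
  .seq (.const 2 0) <| .seq (.op .add 1 1 4) (.op .lt 5 1 0)

def rowRAM (κ : StmtKind) : RAM :=
  .seq rowStartRAM <| .seq (.loop 6 (cellRAM κ)) rowEndRAM

/-- Multiples of `n` come from repeated addition; register 16, the subroutine's register 0, receives
`5 * n + 1`. The case distinction on `κ` selects the code and is not made at run time. -/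
def initRAM (κ : StmtKind) : RAM :=
  .seq (.const 4 1) <| .seq (.op .lt 5 1 0) <|
  .seq (.op .add 9 0 0) <| .seq (.op .add 10 9 0) <| .seq (.op .add 11 10 0) <|
  .seq (.op .add 12 11 0) <| .seq (.op .add 16 12 4) <|
  .seq (match κ with | .starAssign => .copy 13 11 | _ => .const 13 0)
    (match κ with | .assignStar => .copy 14 10 | _ => .copy 14 0)

def dummiesRAM : List StmtKind → RAM
  | [] => .skip
  | k :: ks => .seq (emit k.code 12 12) (dummiesRAM ks)

/-- The preprocessing. -/
def preRAM (κ : StmtKind) (ks : List StmtKind) : RAM :=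
  .seq (initRAM κ) <| .seq (dummiesRAM ks) (.loop 5 (rowRAM κ))

theorem elementary_dummiesRAM (ks : List StmtKind) : (dummiesRAM ks).Elementary := by
  induction ks with
  | nil => trivial
  | cons k ks ih => simp [dummiesRAM, RAM.Elementary, emit, ih]

theorem elementary_preRAM (κ : StmtKind) (ks : List StmtKind) : (preRAM κ ks).Elementary := by
  cases κ <;> simp [preRAM, initRAM, rowRAM, rowStartRAM, rowEndRAM, cellRAM, emit,
    RAM.Elementary, elementary_dummiesRAM]

/-- The arrays when the matrices are `A` and `B` and the statements `L` have been written. -/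
def arrays (A B : ℕ → ℕ) (L : List (StmtKind × ℕ × ℕ)) (a x : ℕ) : ℕ :=
  if a = 0 then A x
  else if a = 1 then B x
  else if a = 16 then (L.map fun t => t.1.code).getD x 0
  else if a = 17 then (L.map fun t => t.2.1).getD x 0
  else if a = 18 then (L.map fun t => t.2.2).getD x 0
  else 0

/-- The default 0 matches the blank cells, so a write to the first free cell appends to the list. -/
theorem update_getD_length (l : List ℕ) (v : ℕ) :
    Function.update (fun x => l.getD x 0) l.length v = fun x => (l ++ [v]).getD x 0 := by
  funext x
  rcases lt_trichotomy x l.length with h | rfl | h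
  · simp [Function.update_of_ne h.ne, List.getD_eq_getElem?_getD, List.getElem?_append_left h]
  · simp
  · rw [Function.update_of_ne h.ne', List.getD_eq_default _ _ h.le,
      List.getD_eq_default _ _ (by simpa using h)]

theorem arrays_append (A B : ℕ → ℕ) (L : List (StmtKind × ℕ × ℕ)) (t : StmtKind × ℕ × ℕ) :
    arrays A B (L ++ [t]) =
      Function.update (Function.update (Function.update (arrays A B L)
        16 (Function.update (arrays A B L 16) L.length t.1.code))
        17 (Function.update (arrays A B L 17) L.length t.2.1))
        18 (Function.update (arrays A B L 18) L.length t.2.2) := by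
  have h1 := update_getD_length (L.map fun t => t.1.code) t.1.code
  have h2 := update_getD_length (L.map fun t => t.2.1) t.2.1
  have h3 := update_getD_length (L.map fun t => t.2.2) t.2.2
  have h (f : StmtKind × ℕ × ℕ → ℕ) : L.map f ++ [f t] = (L ++ [t]).map f := by simp
  rw [List.length_map, h fun t => t.1.code] at h1
  rw [List.length_map, h fun t => t.2.1] at h2
  rw [List.length_map, h fun t => t.2.2] at h3
  funext a x
  by_cases h18 : a = 18
  · subst h18
    rw [Function.update_self]
    exact (congrFun h3 x).symm
  by_cases h17 : a = 17
  · subst h17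
    rw [Function.update_of_ne (by decide), Function.update_self]
    exact (congrFun h2 x).symm
  by_cases h16 : a = 16
  · subst h16
    rw [Function.update_of_ne (by decide), Function.update_of_ne (by decide),
      Function.update_self]
    exact (congrFun h1 x).symm
  simp [arrays, Function.update_of_ne, h18, h17, h16]

theorem code_le (k : StmtKind) : k.code ≤ 3 := by
  cases k <;> simp [StmtKind.code]

/-- The state of the preprocessing with the given loop variables and conditions, after the
statements `L` have been written. -/
def preState (n : ℕ) (κ : StmtKind) (A B : ℕ → ℕ) (L : List (StmtKind × ℕ × ℕ))
    (i j x c c' t u v : ℕ) : State :=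
  mkState [n, i, j, x, 1, c, c', t, u, 2 * n, 3 * n, 4 * n, 5 * n, leftBase n κ, rightBase n κ, v,
    5 * n + 1, L.length] (fun _ => 0) (arrays A B L)

/-! ### Effect and running time of the preprocessing. -/

variable {n : ℕ} {κ : StmtKind} {ks : List StmtKind} {A B : ℕ → ℕ} {L : List (StmtKind × ℕ × ℕ)}
  {i j x c c' t u v W : ℕ}

/-- `emit` overwrites register 15 before it reads its operands; this lets them be read in the state
before the call. -/
theorem reg_preState {r : ℕ} (hr : r ≠ 15) (v' : ℕ) :
    (preState n κ A B L i j x c c' t u v).reg r =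
      (preState n κ A B L i j x c c' t u v').reg r := by
  have h (w : ℕ) : preState n κ A B L i j x c c' t u w =
      (preState n κ A B L i j x c c' t u 0).setReg 15 w := by simp [preState, mkState_setReg]
  rw [h v, h v']
  simp [State.setReg, hr]

theorem setReg_type (k : StmtKind) : (preState n κ A B L i j x c c' t u v).setReg 15 k.code =
    preState n κ A B L i j x c c' t u k.code := by
  simp [preState, mkState_setReg]

theorem eval_emit (k : StmtKind) {a b : ℕ} (ha : a ≠ 15) (hb : b ≠ 15) :
    (emit k.code a b).eval (preState n κ A B L i j x c c' t u v) =
      preState n κ A B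
        (L ++ [(k, (preState n κ A B L i j x c c' t u v).reg a,
          (preState n κ A B L i j x c c' t u v).reg b)]) i j x c c' t u 0 := by
  rw [reg_preState ha k.code, reg_preState hb k.code]
  simp only [emit, RAM.eval, setReg_type, State.reg_setArr]
  generalize (preState n κ A B L i j x c c' t u k.code).reg a = y
  generalize (preState n κ A B L i j x c c' t u k.code).reg b = z
  simp [preState, mkState_setReg, mkState_setArr, arrays_append, Op.eval]

theorem safe_emit (k : StmtKind) {a b : ℕ} (ha : a ≠ 15) (hb : b ≠ 15) :
    (emit k.code a b).Safe W (preState n κ A B L i j x c c' t u v) ↔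
      k.code < W ∧ (preState n κ A B L i j x c c' t u v).reg a < W ∧
        (preState n κ A B L i j x c c' t u v).reg b < W ∧ L.length + 1 < W := by
  rw [reg_preState ha k.code, reg_preState hb k.code]
  simp only [emit, RAM.Safe, RAM.eval, setReg_type, State.reg_setArr]
  generalize (preState n κ A B L i j x c c' t u k.code).reg a = y
  generalize (preState n κ A B L i j x c c' t u k.code).reg b = z
  simp [preState, Op.eval]
  omega

theorem eval_dummiesRAM (ks : List StmtKind) :
    (dummiesRAM ks).eval (preState n κ A B L i j x c c' t u 0) =
      preState n κ A B (L ++ dummies n ks) i j x c c' t u 0 := by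
  induction ks generalizing L with
  | nil => simp [dummiesRAM, dummies, RAM.eval]
  | cons k ks ih =>
    rw [dummiesRAM, RAM.eval, eval_emit k (by decide) (by decide), ih]
    simp [preState, dummies]

theorem safe_dummiesRAM (ks : List StmtKind) (hn : 5 * n < W) (hL : L.length + ks.length + 4 ≤ W) :
    (dummiesRAM ks).Safe W (preState n κ A B L i j x c c' t u 0) := by
  induction ks generalizing L with
  | nil => trivial
  | cons k ks ih =>
    rw [List.length_cons] at hL
    refine ⟨(safe_emit k (by decide) (by decide)).2
      ⟨(code_le k).trans_lt (by omega), hn, hn, by omega⟩, ?_⟩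
    rw [eval_emit k (by decide) (by decide)]
    exact ih (by simp only [List.length_append, List.length_singleton]; omega)

theorem cost_dummiesRAM (ks : List StmtKind) : (dummiesRAM ks).cost = 6 * ks.length + 1 := by
  induction ks with
  | nil => rfl
  | cons k ks ih => simp [dummiesRAM, RAM.cost, emit, ih]; ring

theorem setReg_7 (y : ℕ) : (preState n κ A B L i j x c c' t u v).setReg 7 y =
    preState n κ A B L i j x c c' y u v := by simp [preState, mkState_setReg]

theorem setReg_8 (y : ℕ) : (preState n κ A B L i j x c c' t u v).setReg 8 y =
    preState n κ A B L i j x c c' t y v := by simp [preState, mkState_setReg]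

theorem setReg_15 (y : ℕ) : (preState n κ A B L i j x c c' t u v).setReg 15 y =
    preState n κ A B L i j x c c' t u y := by simp [preState, mkState_setReg]

theorem setReg_1 (y : ℕ) : (preState n κ A B L i j x c c' t u v).setReg 1 y =
    preState n κ A B L y j x c c' t u v := by simp [preState, mkState_setReg]

theorem setReg_2 (y : ℕ) : (preState n κ A B L i j x c c' t u v).setReg 2 y =
    preState n κ A B L i y x c c' t u v := by simp [preState, mkState_setReg]

theorem setReg_3 (y : ℕ) : (preState n κ A B L i j x c c' t u v).setReg 3 y =
    preState n κ A B L i j y c c' t u v := by simp [preState, mkState_setReg]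

theorem setReg_5 (y : ℕ) : (preState n κ A B L i j x c c' t u v).setReg 5 y =
    preState n κ A B L i j x y c' t u v := by simp [preState, mkState_setReg]

theorem setReg_6 (y : ℕ) : (preState n κ A B L i j x c c' t u v).setReg 6 y =
    preState n κ A B L i j x c y t u v := by simp [preState, mkState_setReg]

theorem reg_0 : (preState n κ A B L i j x c c' t u v).reg 0 = n := rfl
theorem reg_1 : (preState n κ A B L i j x c c' t u v).reg 1 = i := rfl
theorem reg_2 : (preState n κ A B L i j x c c' t u v).reg 2 = j := rfl
theorem reg_3 : (preState n κ A B L i j x c c' t u v).reg 3 = x := rfl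
theorem reg_4 : (preState n κ A B L i j x c c' t u v).reg 4 = 1 := rfl
theorem reg_7 : (preState n κ A B L i j x c c' t u v).reg 7 = t := rfl
theorem reg_8 : (preState n κ A B L i j x c c' t u v).reg 8 = u := rfl
theorem reg_9 : (preState n κ A B L i j x c c' t u v).reg 9 = 2 * n := rfl
theorem reg_10 : (preState n κ A B L i j x c c' t u v).reg 10 = 3 * n := rfl
theorem reg_11 : (preState n κ A B L i j x c c' t u v).reg 11 = 4 * n := rfl
theorem reg_13 : (preState n κ A B L i j x c c' t u v).reg 13 = leftBase n κ := rfl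
theorem reg_14 : (preState n κ A B L i j x c c' t u v).reg 14 = rightBase n κ := rfl
theorem reg_15 : (preState n κ A B L i j x c c' t u v).reg 15 = v := rfl
theorem arr_0 : (preState n κ A B L i j x c c' t u v).arr 0 = A := rfl
theorem arr_1 : (preState n κ A B L i j x c c' t u v).arr 1 = B := rfl

/-- The condition of a loop up to `m`. -/
def lt01 (i m : ℕ) : ℕ := if i < m then 1 else 0

theorem eval_add (x y : ℕ) : Op.add.eval x y = x + y := rfl

theorem eval_lt (x y : ℕ) : Op.lt.eval x y = lt01 x y := rfl

theorem lt01_le (i m : ℕ) : lt01 i m ≤ 1 := by unfold lt01; split <;> omega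

theorem runs_cellRAM (hA : A x < 2) (hB : B x < 2) (hi : i < n) (hj : j < n)
    (hW : 5 * n + 4 ≤ W) (hx : x + 1 < W) (hL : L.length + 6 ≤ W) :
    Runs W (cellRAM κ) (preState n κ A B L i j x c c' 0 0 0) 28
      (preState n κ A B (L ++ cell n κ A B i j x) i (j + 1) (x + 1) c (lt01 (j + 1) n) 0 0 0) := by
  have h1 := leftBase_lt (κ := κ) hi
  have h2 := rightBase_lt (κ := κ) hj
  have h3 := lt01_le (j + 1) n
  have h4 := code_le κ
  have key : (cellRAM κ).Safe W (preState n κ A B L i j x c c' 0 0 0) ∧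
      (cellRAM κ).eval (preState n κ A B L i j x c c' 0 0 0) = preState n κ A B
        (L ++ cell n κ A B i j x) i (j + 1) (x + 1) c (lt01 (j + 1) n) 0 0 0 := by
    have h0 : StmtKind.addressOf.code = 0 := rfl
    -- With both branches decided, the code is evaluated symbolically.
    by_cases hA0 : A x = 0 <;> by_cases hB0 : B x = 0 <;>
      simp [cellRAM, RAM.Safe, RAM.eval, setReg_7, setReg_8, setReg_15, setReg_2, setReg_3,
        setReg_6, reg_0, reg_1, reg_2, reg_3, reg_4, reg_7, reg_8, reg_9, reg_13, reg_14, reg_15,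
        arr_0, arr_1, eval_emit, safe_emit, eval_add, eval_lt, cell, hA0, hB0] <;> omega
  rw [← key.2]
  exact key.1.runs

theorem runs_rowStartRAM (hi : i < n) (hW : 5 * n + 4 ≤ W) (hL : L.length + 6 ≤ W) :
    Runs W rowStartRAM (preState n κ A B L i 0 x c 0 0 0 0) 18
      (preState n κ A B (L ++ row n κ A B i 0) i 0 x c (lt01 0 n) 0 0 0) := by
  have h3 := lt01_le 0 n
  have key : rowStartRAM.Safe W (preState n κ A B L i 0 x c 0 0 0 0) ∧
      rowStartRAM.eval (preState n κ A B L i 0 x c 0 0 0 0) =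
        preState n κ A B (L ++ row n κ A B i 0) i 0 x c (lt01 0 n) 0 0 0 := by
    have h0 : StmtKind.addressOf.code = 0 := rfl
    simp [rowStartRAM, RAM.Safe, RAM.eval, setReg_7, setReg_8,
        setReg_6, reg_0, reg_1, reg_2, reg_7, reg_8, reg_10, reg_11,
        eval_emit, safe_emit, eval_add, eval_lt, row]
    omega
  rw [← key.2]
  exact key.1.runs

theorem runs_rowEndRAM (hW : n + 4 ≤ W) (hi : i < n) :
    Runs W rowEndRAM (preState n κ A B L i j x c c' 0 0 0) 3
      (preState n κ A B L (i + 1) 0 x (lt01 (i + 1) n) c' 0 0 0) := by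
  have h3 := lt01_le (i + 1) n
  have key : rowEndRAM.Safe W (preState n κ A B L i j x c c' 0 0 0) ∧
      rowEndRAM.eval (preState n κ A B L i j x c c' 0 0 0) =
        preState n κ A B L (i + 1) 0 x (lt01 (i + 1) n) c' 0 0 0 := by
    simp [rowEndRAM, RAM.Safe, RAM.eval, setReg_1, setReg_2, setReg_5, reg_0, reg_1, reg_4,
      eval_add, eval_lt]
    omega
  rw [← key.2]
  exact key.1.runs

theorem runs_rowRAM (hA : ∀ x, A x < 2) (hB : ∀ x, B x < 2) (hi : i < n) (hW : 5 * n + 4 ≤ W)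
    (hx : n * n + 1 < W) (hL : L.length + 2 * n + 10 ≤ W) :
    Runs W (rowRAM κ) (preState n κ A B L i 0 (i * n) 1 0 0 0 0) (29 * n + 22)
      (preState n κ A B (L ++ row n κ A B i n) (i + 1) 0 ((i + 1) * n)
        (lt01 (i + 1) n) 0 0 0 0) := by
  -- Invariant: before column `j`, the statements of the row for the columns below `j` have been
  -- written.
  have key : Runs W (.loop 6 (cellRAM κ)) _ _ _ := Runs.loop (m := n) (T := 28)
    (fun j => preState n κ A B (L ++ row n κ A B i j) i j (i * n + j) 1 (lt01 j n) 0 0 0)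
    (fun j hj => by simp [preState, lt01, hj]) (by simp [preState, lt01]) fun j hj => by
      rw [row_succ, ← List.append_assoc]
      have h1 := length_row (n := n) (κ := κ) (A := A) (B := B) i j
      exact runs_cellRAM (hA _) (hB _) hi hj hW (by nlinarith)
        (by rw [List.length_append]; omega)
  have h := (runs_rowStartRAM (κ := κ) (A := A) (B := B) (x := i * n) (c := 1) hi hW
    (by omega : L.length + 6 ≤ W)).seq (key.seq (runs_rowEndRAM (by omega) hi))
  have e : lt01 n n = 0 := by simp [lt01]
  rw [← Nat.succ_mul, e] at h
  exact h.mono (by omega)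

/-- The initial state of the preprocessing. -/
def inputState (n : ℕ) (A B : ℕ → ℕ) : State :=
  mkState [n, 0, 0, 0, 0, 0, 0, 0, 0, 0, 0, 0, 0, 0, 0, 0, 0, 0] (fun _ => 0) (arrays A B [])

theorem runs_initRAM (hW : 5 * n + 4 ≤ W) : Runs W (initRAM κ) (inputState n A B) 9
    (preState n κ A B [] 0 0 0 (lt01 0 n) 0 0 0 0) := by
  have h3 := lt01_le 0 n
  have key : (initRAM κ).Safe W (inputState n A B) ∧ (initRAM κ).eval (inputState n A B) =
      preState n κ A B [] 0 0 0 (lt01 0 n) 0 0 0 0 := by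
    have a2 : n + n = 2 * n := by omega
    have a3 : 2 * n + n = 3 * n := by omega
    have a4 : 3 * n + n = 4 * n := by omega
    have a5 : 4 * n + n = 5 * n := by omega
    cases κ <;>
      simp [initRAM, RAM.Safe, RAM.eval, inputState, mkState_setReg, eval_add, eval_lt,
        preState, leftBase, rightBase, a2, a3, a4, a5] <;> omega
  rw [← key.2]
  exact key.1.runs.mono (by cases κ <;> simp [initRAM, RAM.cost])

theorem runs_preRAM (hA : ∀ x, A x < 2) (hB : ∀ x, B x < 2)
    (hW : 2 * (n * n) + 5 * n + ks.length + 20 ≤ W) :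
    Runs W (preRAM κ ks) (inputState n A B) (29 * (n * n) + 23 * n + 6 * ks.length + 20)
      (preState n κ A B (stmts n κ ks A B n) n 0 (n * n) 0 0 0 0 0) := by
  have key : Runs W (.loop 5 (rowRAM κ)) _ _ _ := Runs.loop (m := n) (T := 29 * n + 22)
    (fun i => preState n κ A B (stmts n κ ks A B i) i 0 (i * n) (lt01 i n) 0 0 0 0)
    (fun j hj => by simp [preState, lt01, hj]) (by simp [preState, lt01]) fun i hi => by
      rw [stmts_succ]
      have h1 := length_stmts (n := n) (κ := κ) (ks := ks) (A := A) (B := B) i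
      have h2 : i * (2 + 2 * n) + (2 + 2 * n) ≤ 2 * (n * n) + 2 * n := by nlinarith
      have h3 : lt01 i n = 1 := by simp [lt01, hi]
      simp only [h3]
      exact runs_rowRAM hA hB hi (by omega) (by omega) (by omega)
  have hd := (safe_dummiesRAM (n := n) (κ := κ) (A := A) (B := B) (L := []) (i := 0) (j := 0)
    (x := 0) (c := lt01 0 n) (c' := 0) (t := 0) (u := 0) ks (by omega : 5 * n < W)
    (by simp only [List.length_nil]; omega)).runs
  rw [eval_dummiesRAM, cost_dummiesRAM] at hd
  have e : lt01 n n = 0 := by simp [lt01]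
  have h0 : stmts n κ ks A B 0 = [] ++ dummies n ks := by simp [stmts]
  simp only [h0, e, Nat.zero_mul] at key
  exact ((runs_initRAM (by omega)).seq (hd.seq key)).mono (by nlinarith)

/-! The postprocessing. Register 7 holds the index of the first entry to be copied in the row. -/

/-- Array 19 is the subroutine's output array 3. The answer for `aᵢ` and `cⱼ` is in cell `i * (5 * n
+ 1) + (2 * n + j)`; register 7 holds this for `j = 0` and advances by `5 * n + 1` per row. -/
def copyRAM : RAM :=
  .seq (.op .add 8 7 2) <| .seq (.load 15 19 8) <| .seq (.store 2 3 15) <|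
    .seq (.const 8 0) <| .seq (.const 15 0) <|
    .seq (.op .add 3 3 4) <| .seq (.op .add 2 2 4) (.op .lt 6 2 0)

def nextRowRAM : RAM :=
  .seq (.op .add 7 7 12) <| .seq (.op .add 7 7 4) <| .seq (.const 2 0) <|
    .seq (.op .add 1 1 4) (.op .lt 5 1 0)

def copyRowRAM : RAM :=
  .seq (.op .lt 6 2 0) <| .seq (.loop 6 copyRAM) nextRowRAM

/-- The column counter needs no reset, since the preprocessing leaves it at 0. -/
def startRAM : RAM :=
  .seq (.const 1 0) <| .seq (.const 3 0) <| .seq (.copy 7 9) (.op .lt 5 1 0)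

/-- The postprocessing. -/
def postRAM : RAM := .seq startRAM (.loop 5 copyRowRAM)

theorem elementary_postRAM : postRAM.Elementary := by
  simp [postRAM, startRAM, copyRowRAM, nextRowRAM, copyRAM, RAM.Elementary]

/-- The entry number `y` of the product, in the result of the analysis. -/
def entry (n : ℕ) (g : ℕ → ℕ → ℕ) (y : ℕ) : ℕ :=
  g 19 (y / n * (5 * n + 1) + (2 * n + y % n))

/-- The state of the postprocessing with the given loop variables and conditions, after the entries
below `m` have been written. -/
def postState (n : ℕ) (κ : StmtKind) (f : ℕ → ℕ) (g : ℕ → ℕ → ℕ) (m i j x c c' p : ℕ) : State :=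
  mkState [n, i, j, x, 1, c, c', p, 0, 2 * n, 3 * n, 4 * n, 5 * n, leftBase n κ, rightBase n κ, 0]
    f (Function.update g 2 fun y => if y < m then entry n g y else g 2 y)

/-! ### Effect and running time of the postprocessing. -/

variable {n : ℕ} {κ : StmtKind} {f : ℕ → ℕ} {g : ℕ → ℕ → ℕ} {m i j x c c' p W : ℕ}

theorem update_entry : Function.update (fun y => if y < x then entry n g y else g 2 y) x
    (entry n g x) = fun y => if y < x + 1 then entry n g y else g 2 y := by
  funext y
  rcases lt_trichotomy y x with h | rfl | h
  · simp [Function.update_of_ne h.ne, h, h.trans x.lt_succ_self]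
  · simp
  · simp [Function.update_of_ne h.ne', h.not_gt, h]

theorem runs_copyRAM (he : entry n g x = g 19 (p + j)) (h2 : g 19 (p + j) ≤ 1)
    (hW : 5 * n + 4 ≤ W) (hj : j < n) (hx : x + 1 < W) (hp : p + j < W) :
    Runs W copyRAM (postState n κ f g x i j x c c' p) 8
      (postState n κ f g (x + 1) i (j + 1) (x + 1) c (lt01 (j + 1) n) p) := by
  have h3 := lt01_le (j + 1) n
  have hu := update_entry (n := n) (g := g) (x := x)
  rw [he] at hu
  have key : copyRAM.Safe W (postState n κ f g x i j x c c' p) ∧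
      copyRAM.eval (postState n κ f g x i j x c c' p) =
        postState n κ f g (x + 1) i (j + 1) (x + 1) c (lt01 (j + 1) n) p := by
    simp [copyRAM, RAM.Safe, RAM.eval, postState, mkState_setReg, mkState_setArr, eval_add,
      eval_lt, hu]
    omega
  rw [← key.2]
  exact key.1.runs

theorem runs_nextRowRAM (hi : i < n) (hW : n + 4 ≤ W) (hp : p + (5 * n + 1) < W) :
    Runs W nextRowRAM (postState n κ f g m i j x c c' p) 5
      (postState n κ f g m (i + 1) 0 x (lt01 (i + 1) n) c' (p + (5 * n + 1))) := by
  have h3 := lt01_le (i + 1) n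
  have key : nextRowRAM.Safe W (postState n κ f g m i j x c c' p) ∧
      nextRowRAM.eval (postState n κ f g m i j x c c' p) =
        postState n κ f g m (i + 1) 0 x (lt01 (i + 1) n) c' (p + (5 * n + 1)) := by
    simp [nextRowRAM, RAM.Safe, RAM.eval, postState, mkState_setReg, eval_add, eval_lt,
      ← add_assoc]
    omega
  rw [← key.2]
  exact key.1.runs

theorem runs_copyRowRAM (hg : ∀ i < n, ∀ j < n, g 19 (i * (5 * n + 1) + (2 * n + j)) ≤ 1)
    (hi : i < n) (hW : 5 * (n * n) + 8 * n + 4 ≤ W) :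
    Runs W copyRowRAM
      (postState n κ f g (i * n) i 0 (i * n) 1 0 (i * (5 * n + 1) + 2 * n)) (9 * n + 7)
      (postState n κ f g ((i + 1) * n) (i + 1) 0 ((i + 1) * n) (lt01 (i + 1) n) 0
        ((i + 1) * (5 * n + 1) + 2 * n)) := by
  have hp : i * (5 * n + 1) + (5 * n + 1) ≤ 5 * (n * n) + n := by nlinarith
  have hl : i * n + n ≤ n * n := by nlinarith
  have key : Runs W (.loop 6 copyRAM) _ _ _ := Runs.loop (m := n) (T := 8)
    (fun j => postState n κ f g (i * n + j) i j (i * n + j) 1 (lt01 j n)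
      (i * (5 * n + 1) + 2 * n))
    (fun j hj => by simp [postState, lt01, hj]) (by simp [postState, lt01]) fun j hj => by
      have he : entry n g (i * n + j) = g 19 (i * (5 * n + 1) + 2 * n + j) := by
        rw [entry, mul_comm i n, Nat.mul_add_div (by omega), Nat.div_eq_of_lt hj,
          Nat.mul_add_mod, Nat.mod_eq_of_lt hj, add_zero, add_assoc]
      have := hg i hi j hj
      rw [← add_assoc] at this
      exact runs_copyRAM he this (by omega) hj (by omega) (by omega)
  have h0 : Runs W (.op .lt 6 2 0)
      (postState n κ f g (i * n) i 0 (i * n) 1 0 (i * (5 * n + 1) + 2 * n)) 1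
      (postState n κ f g (i * n) i 0 (i * n) 1 (lt01 0 n) (i * (5 * n + 1) + 2 * n)) := by
    have h3 := lt01_le 0 n
    have h : (RAM.op .lt 6 2 0).Safe W
        (postState n κ f g (i * n) i 0 (i * n) 1 0 (i * (5 * n + 1) + 2 * n)) := by
      simp [RAM.Safe, postState, eval_lt]
      omega
    simpa [RAM.eval, RAM.cost, postState, mkState_setReg, eval_lt] using h.runs
  have h := h0.seq (key.seq (runs_nextRowRAM hi (by omega) (by omega)))
  have e : lt01 n n = 0 := by simp [lt01]
  have e' : i * (5 * n + 1) + 2 * n + (5 * n + 1) = (i + 1) * (5 * n + 1) + 2 * n := by ring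
  rw [← Nat.succ_mul, e, e'] at h
  exact h.mono (by omega)

theorem runs_postRAM (hg : ∀ i < n, ∀ j < n, g 19 (i * (5 * n + 1) + (2 * n + j)) ≤ 1)
    (hW : 5 * (n * n) + 8 * n + 4 ≤ W) :
    Runs W postRAM (postState n κ f g 0 n 0 (n * n) 0 0 0) (9 * (n * n) + 8 * n + 5)
      (postState n κ f g (n * n) n 0 (n * n) 0 0 (n * (5 * n + 1) + 2 * n)) := by
  have key : Runs W (.loop 5 copyRowRAM) _ _ _ := Runs.loop (m := n) (T := 9 * n + 7)
    (fun i => postState n κ f g (i * n) i 0 (i * n) (lt01 i n) 0 (i * (5 * n + 1) + 2 * n))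
    (fun j hj => by simp [postState, lt01, hj]) (by simp [postState, lt01]) fun i hi => by
      have h3 : lt01 i n = 1 := by simp [lt01, hi]
      simp only [h3]
      exact runs_copyRowRAM hg hi hW
  have h0 : Runs W startRAM (postState n κ f g 0 n 0 (n * n) 0 0 0) 4
      (postState n κ f g 0 0 0 0 (lt01 0 n) 0 (2 * n)) := by
    have h3 := lt01_le 0 n
    have h : startRAM.Safe W (postState n κ f g 0 n 0 (n * n) 0 0 0) := by
      simp [startRAM, RAM.Safe, RAM.eval, postState, mkState_setReg, eval_lt]
      omega
    simpa [startRAM, RAM.eval, RAM.cost, postState, mkState_setReg, eval_lt] using h.runs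
  have e : lt01 n n = 0 := by simp [lt01]
  simp only [e, Nat.zero_mul, Nat.zero_add] at key
  exact (h0.seq key).mono (by nlinarith)

/-! The reduction. -/

theorem matrixArray_lt_two {n : ℕ} (A : Matrix (Fin n) (Fin n) Bool) (x : ℕ) :
    matrixArray A x < 2 := by
  unfold matrixArray
  split
  · exact Bool.toNat_lt _
  · norm_num

theorem matrixArray_ne_zero {n : ℕ} (A : Matrix (Fin n) (Fin n) Bool) (i j : Fin n) :
    matrixArray A (i * n + j) ≠ 0 ↔ A i j = true := by
  have h : (i : ℕ) * n + j < n * n := by nlinarith [i.2, j.2]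
  have h1 : (i * n + j : ℕ) / n = i := by
    rw [mul_comm, Nat.mul_add_div i.pos, Nat.div_eq_of_lt j.2, add_zero]
  have h2 : (i * n + j : ℕ) % n = j := by
    rw [mul_comm, Nat.mul_add_mod, Nat.mod_eq_of_lt j.2]
  simp only [matrixArray, h, dif_pos, h1, h2, Fin.eta]
  cases A i j <;> simp

theorem bmmInput_eq {n : ℕ} (A B : Matrix (Fin n) (Fin n) Bool) :
    bmmInput A B = inputState n (matrixArray A) (matrixArray B) := by
  ext r x
  · by_cases hr : r < 18
    · interval_cases r <;> rfl
    · have : r ≠ 0 := by omega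
      simp [bmmInput, inputState, List.getD_eq_getElem?_getD, this,
        List.getElem?_eq_none (by simpa using hr :
          [n, 0, 0, 0, 0, 0, 0, 0, 0, 0, 0, 0, 0, 0, 0, 0, 0, 0].length ≤ r)]
  · simp only [bmmInput, inputState, mkState_arr, arrays, List.map_nil, List.getD_nil, ite_self]
    split <;> [rfl; split <;> rfl]

/-- The subroutine must see its exact input with zeros elsewhere, which is why all scratch registers
and both matrices lie below 16. -/
theorem above_preState {ks : List StmtKind} {A B : ℕ → ℕ} (hκ : κ ≠ .addressOf) (hks : ks.Nodup) :
    (preState n κ A B (stmts n κ ks A B n) n 0 (n * n) 0 0 0 0 0).above 16 =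
      paInput (program (n := n) A B hκ hks) := by
  have h1 : (program (n := n) A B hκ hks).stmts.map (fun s => s.kind.code) =
      (stmts n κ ks A B n).map fun t => t.1.code := by
    simp [program, toStmt]
  have h2 : (program (n := n) A B hκ hks).stmts.map (fun s => (s.lhs : ℕ)) =
      (stmts n κ ks A B n).map fun t => t.2.1 := by
    rw [program, List.map_map]
    exact List.map_congr_left fun t ht => lhs_toStmt ht
  have h3 : (program (n := n) A B hκ hks).stmts.map (fun s => (s.rhs : ℕ)) =
      (stmts n κ ks A B n).map fun t => t.2.2 := by
    rw [program, List.map_map]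
    exact List.map_congr_left fun t ht => rhs_toStmt ht
  ext r x
  · match r with
    | 0 => rfl
    | 1 => simp [State.above, preState, paInput, program]
    | r + 2 => simp [State.above, preState, paInput]
  · simp only [State.above, preState, mkState_arr, paInput, h1, h2, h3]
    match r with
    | 0 => rfl
    | 1 => rfl
    | 2 => rfl
    | r + 3 => simp [arrays]

/-- The reduction of Boolean matrix multiplication to points-to analysis. -/
def reduction (κ : StmtKind) (ks : List StmtKind) : Reduction where
  pre := preRAM κ ks
  k := 16
  post := postRAM

theorem reducesBMM {ks : List StmtKind} (hκ : κ ≠ .addressOf) (hks : ks.Nodup) (hκs : κ ∈ ks)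
    (h0 : .addressOf ∈ ks) (hl : ks.length ≤ 4) :
    (reduction κ ks).ReducesBMM {k | k ∈ ks} := by
  -- The word bound uses `32 * (n + 2) ^ 2 ≤ (n + 2) ^ 7`, which exceeds every number written; 50
  -- covers both running times, given `ks.length ≤ 4`, and the `5 * n + 1` variables.
  refine ⟨7, 50, fun n A B => ⟨5 * n + 1, program (matrixArray A) (matrixArray B) hκ hks, ?_⟩⟩
  have hW : 32 * (n * n) + 128 * n + 128 ≤ (n + 2) ^ 7 :=
    calc 32 * (n * n) + 128 * n + 128 = 2 ^ 5 * (n + 2) ^ 2 := by ring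
      _ ≤ (n + 2) ^ 5 * (n + 2) ^ 2 :=
        Nat.mul_le_mul_right _ (Nat.pow_le_pow_left (by omega) _)
      _ = (n + 2) ^ 7 := (pow_add _ _ _).symm
  have hC : 50 * (n + 1) ^ 2 = 50 * (n * n) + 100 * n + 50 := by ring
  obtain ⟨t, ht, e⟩ := runs_preRAM (κ := κ) (ks := ks) (n := n) (W := (n + 2) ^ 7)
    (matrixArray_lt_two A) (matrixArray_lt_two B) (by omega)
  rw [← bmmInput_eq] at e
  refine ⟨t, _, by omega, kinds_program hκ hks hκs h0, e, ht.trans (by omega),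
    above_preState hκ hks, fun s₁ hr ha hout => ?_⟩
  -- The subroutine may leave anything from 16 on; the 16 protected registers fix the listed part.
  have hs : s₁ = postState n κ s₁.reg s₁.arr 0 n 0 (n * n) 0 0 0 := by
    have : s₁ = mkState [n, n, 0, n * n, 1, 0, 0, 0, 0, 2 * n, 3 * n, 4 * n, 5 * n,
        leftBase n κ, rightBase n κ, 0] s₁.reg s₁.arr := by
      refine eq_mkState fun r hr' => ?_
      rw [hr r hr']
      change r < 16 at hr'
      interval_cases r <;> rfl
    exact this.trans (by simp [postState])
  have hbit (i j : Fin n) : IsBit (s₁.arr 19 (i * (5 * n + 1) + (2 * n + j)))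
      (∃ k, A i k = true ∧ B k j = true) := by
    have := hout ⟨i, by omega⟩ ⟨2 * n + j, by omega⟩
    rw [mem_pt_program hκ hks i.2 j.2 rfl rfl] at this
    have hiff : (∃ k < n, matrixArray A (i * n + k) ≠ 0 ∧ matrixArray B (k * n + j) ≠ 0) ↔
        ∃ k, A i k = true ∧ B k j = true := by
      constructor
      · rintro ⟨k, hk, h1, h2⟩
        exact ⟨⟨k, hk⟩, (matrixArray_ne_zero A i ⟨k, hk⟩).1 h1,
          (matrixArray_ne_zero B ⟨k, hk⟩ j).1 h2⟩
      · rintro ⟨k, h1, h2⟩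
        exact ⟨k, k.2, (matrixArray_ne_zero A i k).2 h1, (matrixArray_ne_zero B k j).2 h2⟩
    rwa [hiff] at this
  obtain ⟨t', ht', e'⟩ := runs_postRAM (κ := κ) (f := s₁.reg) (g := s₁.arr) (n := n)
    (W := (n + 2) ^ 7)
    -- The copied values are bits, so they fit into a word.
    (fun i hi j hj => by
      have := hbit ⟨i, hi⟩ ⟨j, hj⟩
      by_cases h : ∃ k, A ⟨i, hi⟩ k = true ∧ B k ⟨j, hj⟩ = true
      · exact (this.1 h).le
      · exact (this.2 h).le.trans zero_le_one) (by omega)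
  rw [← hs] at e'
  refine ⟨t', _, e', ht'.trans (by omega), fun i j => ?_⟩
  have h : (i : ℕ) * n + j < n * n := by nlinarith [i.2, j.2]
  have h1 : (i * n + j : ℕ) / n = i := by
    rw [mul_comm, Nat.mul_add_div i.pos, Nat.div_eq_of_lt j.2, add_zero]
  have h2 : (i * n + j : ℕ) % n = j := by
    rw [mul_comm, Nat.mul_add_mod, Nat.mod_eq_of_lt j.2]
  simpa [postState, h, entry, h1, h2] using hbit i j

end Encoding

theorem corollary1 (K : Set StmtKind) (hK : NonTrivial K) : BMMHard K := by
  classical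
  obtain ⟨h0, κ, hκK, hκ⟩ := hK
  -- Filtering this list presents `K` as a duplicate-free list of length at most 4, from which the
  -- code is built.
  let all : List StmtKind := [.addressOf, .assign, .assignStar, .starAssign]
  have hmem (k : StmtKind) : k ∈ all.filter (· ∈ K) ↔ k ∈ K := by
    cases k <;> simp [all]
  have hK : {k | k ∈ all.filter (· ∈ K)} = K := Set.ext hmem
  have hR := Encoding.reducesBMM hκ (List.Nodup.filter _ (by simp [all]) :
    (all.filter (· ∈ K)).Nodup) ((hmem κ).2 hκK) ((hmem _).2 h0) (List.length_filter_le _ _)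
  rw [hK] at hR
  exact ⟨_, Encoding.elementary_preRAM κ _, Encoding.elementary_postRAM, hR,
    fun δ hδ Q hQ => hR.solvesBMM hδ hQ⟩
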